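/- Let $R$ be a commutative Noetherian ring with identity, $\mathfrak a$ an ideal of $R$, $N$ a finitely generated $\mathfrak a$-torsion $R$-module (every element of $N$ is annihilated by some power of $\mathfrak a$), and $\mathcal S$ a Serre subcategory of the category of $R$-modules (a class of modules containing $0$ and closed under submodules, quotients and extensions). Write $H^i_{\mathfrak a}$ for the $i$-th local cohomology functor, that is, the $i$-th right derived functor of $\Gamma_{\mathfrak a}(M)=\{x\in M : \mathfrak a^k x=0 \text{ for some } k\ge 0\}$. Let $X$ be an arbitrary $R$-module and let $n\le m$ be non-negative integers. (1) If $H^i_{\mathfrak a}(X)\in\mathcal S$ for all $i\ne n$, then for every $i\ge 0$, $$\operatorname{Ext}^i_R(N,H^n_{\mathfrak a}(X))\in\mathcal S \iff \operatorname{Ext}^{i+n}_R(N,X)\in\mathcal S.$$ (2) If $H^i_{\mathfrak a}(X)\in\mathcal S$ for all $i$ with $0\le i\le n-1$ or $n+1\le i\le m$, then for every $i$ with $0\le i\le m-n$, $$\operatorname{Ext}^i_R(N,H^n_{\mathfrak a}(X))\in\mathcal S \iff \operatorname{Ext}^{i+n}_R(N,X)\in\mathcal S.$$ -/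

import Mathlib

open CategoryTheory

universe u

noncomputable section

/-- The `a`-torsion functor `Γ_a` on `R`-modules. It sends `M` to the submodule
`Γ_a(M) = {x ∈ M | a ^ k x = 0 for some k}` (in Mathlib: `Ideal.primaryComponent M a`), and a
linear map to its restriction. -/
def torsionFunctor {R : Type u} [CommRing R] (a : Ideal R) :
    ModuleCat.{u} R ⥤ ModuleCat.{u} R where
  obj M := ModuleCat.of R (Ideal.primaryComponent M a)
  map f := ModuleCat.ofHom (Ideal.primaryComponent.map a f.hom)

theorem mem_torsionFunctor_iff {R : Type u} [CommRing R] (a : Ideal R) (M : ModuleCat.{u} R)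
    (x : M) :
    x ∈ Ideal.primaryComponent M a ↔ ∃ k : ℕ, ∀ r ∈ a ^ k, r • x = 0 := by
  simp only [Ideal.primaryComponent_mem, Submodule.mem_torsionBySet_iff, SetLike.coe_sort_coe,
    Subtype.forall]

instance torsionFunctor_additive {R : Type u} [CommRing R] (a : Ideal R) :
    (torsionFunctor a).Additive where
  map_add {_ _ _ _} := rfl

/-- The local cohomology module `H^i_a(X)`: the value at `X` of the `i`-th right derived functor
of the `a`-torsion functor `Γ_a`. -/
def localCohomologyModule {R : Type u} [CommRing R] (a : Ideal R) (i : ℕ) (X : ModuleCat.{u} R) :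
    ModuleCat.{u} R :=
  ((torsionFunctor a).rightDerived i).obj X

/-- The `R`-module `Ext^i_R(N, X)`. -/
def extModule {R : Type u} [CommRing R] (i : ℕ) (N X : ModuleCat.{u} R) : ModuleCat.{u} R :=
  ModuleCat.of R (Abelian.Ext.{u} N X i)

/-- `N` is `a`-torsion, that is, `Γ_a(N) = N`: every element of `N` is annihilated by a power
of `a`. -/
def IsIdealTorsion {R : Type u} [CommRing R] (a : Ideal R) (N : ModuleCat.{u} R) : Prop :=
  Ideal.primaryComponent N a = ⊤

end

/-! Take an injective resolution I of X and let Y p be the p-cycles modulo d(Γ_a(I^(p-1))), so Y 0 ≅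
X. With E p = I^p / Γ_a(I^p) there are exact sequences 0 → H^p_a(X) → Y p → E p → Y (p+1) → 0. By
Artin–Rees Γ_a(I^p) is injective, so E p is injective too; it has no a-torsion, so Ext^i(N, E p) = 0
for all i. Modulo S, dimension shifting gives Ext^(i+n)(N, X) ~ Ext^i(N, Y n) when the H^j with j <
n lie in S, and Ext^i(N, Y n) ~ Ext^i(N, H^n) when those with n < j ≤ n + i do. No spectral sequence
is needed. -/

lemma ModuleCat.shortExact_mk_of_linear {R : Type u} [CommRing R] {A B C : Type u}
    [AddCommGroup A] [Module R A] [AddCommGroup B] [Module R B] [AddCommGroup C] [Module R C]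
    (f : A →ₗ[R] B) (g : B →ₗ[R] C) (hf : Function.Injective f) (hfg : Function.Exact f g)
    (hg : Function.Surjective g) :
    (ShortComplex.mk (ModuleCat.ofHom f) (ModuleCat.ofHom g)
      (by ext x; exact hfg.apply_apply_eq_zero x)).ShortExact where
  exact := by
    rw [ShortComplex.ShortExact.moduleCat_exact_iff_function_exact]
    exact hfg
  mono_f := (ModuleCat.mono_iff_injective _).2 hf
  epi_g := (ModuleCat.epi_iff_surjective _).2 hg

/-! ### Serre classes and Ext -/

section SerreClass

variable {R : Type u} [CommRing R] (S : ObjectProperty (ModuleCat.{u} R)) [S.IsSerreClass]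

lemma prop_of_linear_exact {A B C : Type u} [AddCommGroup A] [Module R A] [AddCommGroup B]
    [Module R B] [AddCommGroup C] [Module R C] (f : A →ₗ[R] B) (g : B →ₗ[R] C)
    (h : Function.Exact f g) (hA : S (ModuleCat.of R A)) (hC : S (ModuleCat.of R C)) :
    S (ModuleCat.of R B) := by
  refine S.prop_X₂_of_exact (S := ShortComplex.mk (ModuleCat.ofHom f) (ModuleCat.ofHom g)
    (by ext x; exact h.apply_apply_eq_zero x)) ?_ hA hC
  rw [ShortComplex.ShortExact.moduleCat_exact_iff_function_exact]
  exact h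

lemma prop_of_subsingleton (A : Type u) [AddCommGroup A] [Module R A] [Subsingleton A] :
    S (ModuleCat.of R A) :=
  S.prop_of_isZero (ModuleCat.isZero_of_subsingleton _)

lemma prop_of_linear_injective {A B : Type u} [AddCommGroup A] [Module R A] [AddCommGroup B]
    [Module R B] (f : A →ₗ[R] B) (h : Function.Injective f) (hB : S (ModuleCat.of R B)) :
    S (ModuleCat.of R A) :=
  prop_of_linear_exact S (0 : PUnit.{u + 1} →ₗ[R] A) f
    ((LinearMap.exact_zero_iff_injective _ _).2 h) (prop_of_subsingleton S _) hB

lemma prop_finite_pi (A : Type u) [AddCommGroup A] [Module R A] (hA : S (ModuleCat.of R A))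
    (k : ℕ) : S (ModuleCat.of R (Fin k → A)) := by
  induction k with
  | zero => exact prop_of_subsingleton S _
  | succ k ih =>
    refine prop_of_linear_exact S (LinearMap.single R (fun _ : Fin (k + 1) ↦ A) 0)
      (LinearMap.funLeft R A Fin.succ) (fun x ↦ ⟨fun hx ↦ ⟨x 0, ?_⟩, ?_⟩) hA ih
    · funext j
      refine Fin.cases ?_ (fun j ↦ ?_) j
      · simp
      · simpa using (congrFun hx j).symm
    · rintro ⟨y, rfl⟩
      funext j
      simp [LinearMap.funLeft_apply]

/-- A surjection R^k → N embeds Hom(N, M) in M^k, and its kernel, finite since R is Noetherian, has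
Ext^i mapping onto Ext^(i+1)(N, M). -/
lemma extModule_prop_of_prop [IsNoetherianRing R] (M : ModuleCat.{u} R) (hM : S M) (i : ℕ)
    (N : ModuleCat.{u} R) [Module.Finite R N] : S (extModule i N M) := by
  induction i generalizing N with
  | zero =>
    obtain ⟨k, f, hf⟩ := Module.Finite.exists_fin' R N
    refine prop_of_linear_injective S (B := Fin k → M)
      ({ toFun φ j := φ.hom (f (Pi.single j 1)), map_add' _ _ := rfl, map_smul' _ _ := rfl } ∘ₗ
        (Abelian.Ext.linearEquiv₀ (R := R) (X := N) (Y := M)).toLinearMap) ?_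
        (prop_finite_pi S M hM k)
    rw [LinearMap.coe_comp]
    refine Function.Injective.comp (fun φ ψ h ↦ ?_) (LinearEquiv.injective _)
    have h' : φ.hom ∘ₗ f = ψ.hom ∘ₗ f := by
      ext j
      exact congrFun h j
    ext x
    obtain ⟨y, rfl⟩ := hf x
    exact LinearMap.congr_fun h' y
  | succ i ih =>
    obtain ⟨k, f, hf⟩ := Module.Finite.exists_fin' R N
    let T : ShortComplex (ModuleCat.{u} R) := ShortComplex.mk
      (ModuleCat.ofHom (LinearMap.ker f).subtype) (ModuleCat.ofHom f) (by ext x; exact x.2)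
    have hT : T.ShortExact := ModuleCat.shortExact_mk_of_linear _ _ Subtype.val_injective
      (LinearMap.exact_subtype_ker_map f) hf
    have : Module.Finite R T.X₁ := inferInstanceAs (Module.Finite R (LinearMap.ker f))
    have : Projective T.X₂ := ModuleCat.projective_of_free (Pi.basisFun R (Fin k))
    refine prop_of_linear_exact S (hT.extClass.precompOfLinear R M (add_comm 1 i))
      (0 : _ →ₗ[R] PUnit.{u + 1}) ?_ (ih T.X₁) (prop_of_subsingleton S _)
    rw [LinearMap.exact_zero_iff_surjective]
    intro x
    exact Abelian.Ext.contravariant_sequence_exact₃ hT M x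
      (Abelian.Ext.eq_zero_of_projective _) (add_comm 1 i)

section CovariantSequence

variable (N : ModuleCat.{u} R) {T : ShortComplex (ModuleCat.{u} R)} (hT : T.ShortExact)
include hT

lemma extModule_X₂ (i : ℕ) (h₁ : S (extModule i N T.X₁)) (h₃ : S (extModule i N T.X₃)) :
    S (extModule i N T.X₂) := by
  refine prop_of_linear_exact S
    ((Abelian.Ext.mk₀ T.f).postcompOfLinear R N (add_zero i))
    ((Abelian.Ext.mk₀ T.g).postcompOfLinear R N (add_zero i)) (fun x ↦ ⟨fun hx ↦ ?_, ?_⟩) h₁ h₃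
  · exact Abelian.Ext.covariant_sequence_exact₂ N hT x hx
  · rintro ⟨y, rfl⟩
    simp

lemma extModule_X₃ (i : ℕ) (h₂ : S (extModule i N T.X₂)) (h₁ : S (extModule (i + 1) N T.X₁)) :
    S (extModule i N T.X₃) := by
  refine prop_of_linear_exact S
    ((Abelian.Ext.mk₀ T.g).postcompOfLinear R N (add_zero i))
    (hT.extClass.postcompOfLinear R N rfl) (fun x ↦ ⟨fun hx ↦ ?_, ?_⟩) h₂ h₁
  · exact Abelian.Ext.covariant_sequence_exact₃ N hT x rfl hx
  · rintro ⟨y, rfl⟩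
    simp

lemma extModule_X₁_succ (i : ℕ) (h₃ : S (extModule i N T.X₃))
    (h₂ : S (extModule (i + 1) N T.X₂)) : S (extModule (i + 1) N T.X₁) := by
  refine prop_of_linear_exact S
    (hT.extClass.postcompOfLinear R N rfl)
    ((Abelian.Ext.mk₀ T.f).postcompOfLinear R N (add_zero (i + 1))) (fun x ↦ ⟨fun hx ↦ ?_, ?_⟩)
    h₃ h₂
  · exact Abelian.Ext.covariant_sequence_exact₁ N hT x hx rfl
  · rintro ⟨y, rfl⟩
    simp

lemma extModule_X₁_zero (h₂ : S (extModule 0 N T.X₂)) : S (extModule 0 N T.X₁) :=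
  have := hT.mono_f
  prop_of_linear_injective S ((Abelian.Ext.mk₀ T.f).postcompOfLinear R N (add_zero 0))
    (Abelian.Ext.postcomp_mk₀_injective_of_mono N T.f) h₂

end CovariantSequence

lemma extModule_prop_iff_of_iso (i : ℕ) (N : ModuleCat.{u} R) {X Y : ModuleCat.{u} R}
    (e : X ≅ Y) : S (extModule i N X) ↔ S (extModule i N Y) := by
  suffices H : ∀ {X Y : ModuleCat.{u} R}, (X ≅ Y) → S (extModule i N X) → S (extModule i N Y) from
    ⟨H e, H e.symm⟩
  intro X Y e h
  refine prop_of_linear_injective S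
    ((Abelian.Ext.mk₀ e.inv).postcompOfLinear R N (add_zero i)) ?_ h
  refine Function.LeftInverse.injective
    (g := (Abelian.Ext.mk₀ e.hom).postcompOfLinear R N (add_zero i)) fun x ↦ ?_
  simp

end SerreClass

/-- Dimension shifting along exact sequences `0 → H p → Y p → E p → Y (p + 1) → 0` (split at `W p`)
in which all `Ext^i(N, E p)` lie in the Serre class. -/
structure ExtShiftSequence {R : Type u} [CommRing R] (S : ObjectProperty (ModuleCat.{u} R))
    (N : ModuleCat.{u} R) (H Y : ℕ → ModuleCat.{u} R) : Prop where
  exists_shortExact : ∀ p, ∃ (T U : ShortComplex (ModuleCat.{u} R)),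
    T.ShortExact ∧ U.ShortExact ∧ Nonempty (T.X₁ ≅ H p) ∧ T.X₂ = Y p ∧ T.X₃ = U.X₁ ∧ U.X₃ = Y (p + 1) ∧
      ∀ i, S (extModule i N U.X₂)

/-! ### Dimension shifting -/

namespace ExtShiftSequence

variable {R : Type u} [CommRing R] [IsNoetherianRing R] {S : ObjectProperty (ModuleCat.{u} R)}
  [S.IsSerreClass] {N : ModuleCat.{u} R} [Module.Finite R N] {H Y : ℕ → ModuleCat.{u} R}
  (h : ExtShiftSequence S N H Y)
include h

lemma prop_of_prop (i p : ℕ) (hH : ∀ j, p ≤ j → j ≤ p + i → S (H j)) :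
    S (extModule i N (Y p)) := by
  induction i generalizing p with
  | zero =>
    obtain ⟨T, U, hT, hU, ⟨h₁⟩, h₂, h₃, h₄, hE⟩ := h.exists_shortExact p
    rw [← h₂]
    refine extModule_X₂ S N hT 0 ?_ ?_
    · exact extModule_prop_of_prop S _ ((S.prop_iff_of_iso h₁).2 (hH p le_rfl (by lia))) _ _
    · rw [h₃]
      exact extModule_X₁_zero S N hU (hE 0)
  | succ i ih =>
    obtain ⟨T, U, hT, hU, ⟨h₁⟩, h₂, h₃, h₄, hE⟩ := h.exists_shortExact p
    rw [← h₂]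
    refine extModule_X₂ S N hT _ ?_ ?_
    · exact extModule_prop_of_prop S _ ((S.prop_iff_of_iso h₁).2 (hH p le_rfl (by lia))) _ _
    · rw [h₃]
      refine extModule_X₁_succ S N hU i ?_ (hE _)
      rw [h₄]
      exact ih _ fun j _ _ ↦ hH j (by lia) (by lia)

/-- With W = `T.X₃`, Ext^j(N, W) lies in S for j ≤ i, as it is controlled by Ext^(j-1)(N, Y (p+1)).
-/
lemma prop_iff (i p : ℕ) (hH : ∀ j, p < j → j ≤ p + i → S (H j)) :
    S (extModule i N (H p)) ↔ S (extModule i N (Y p)) := by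
  obtain ⟨T, U, hT, hU, ⟨h₁⟩, h₂, h₃, h₄, hE⟩ := h.exists_shortExact p
  have hW (j : ℕ) (hj : j ≤ i) : S (extModule j N T.X₃) := by
    rw [h₃]
    cases j with
    | zero => exact extModule_X₁_zero S N hU (hE 0)
    | succ j =>
      refine extModule_X₁_succ S N hU j ?_ (hE _)
      rw [h₄]
      exact h.prop_of_prop j _ fun l _ _ ↦ hH l (by lia) (by lia)
  rw [← extModule_prop_iff_of_iso S i N h₁, ← h₂]
  refine ⟨fun hi ↦ extModule_X₂ S N hT i hi (hW i le_rfl), fun hi ↦ ?_⟩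
  cases i with
  | zero => exact extModule_X₁_zero S N hT hi
  | succ i => exact extModule_X₁_succ S N hT i (hW i (by lia)) hi

/-- Modulo S, the Ext modules into H p and E p vanish, so both sides compare with Ext^(i+1)(N, W p).
-/
lemma prop_succ_iff (i p : ℕ) (hH : S (H p)) :
    S (extModule (i + 1) N (Y p)) ↔ S (extModule i N (Y (p + 1))) := by
  obtain ⟨T, U, hT, hU, ⟨h₁⟩, h₂, h₃, h₄, hE⟩ := h.exists_shortExact p
  have hX (j : ℕ) : S (extModule j N T.X₁) :=
    extModule_prop_of_prop S _ ((S.prop_iff_of_iso h₁).2 hH) _ _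
  rw [← h₂, ← h₄]
  constructor
  · intro hY
    have := extModule_X₃ S N hT _ hY (hX _)
    rw [h₃] at this
    exact extModule_X₃ S N hU _ (hE _) this
  · intro hY
    have := extModule_X₁_succ S N hU _ hY (hE _)
    rw [← h₃] at this
    exact extModule_X₂ S N hT _ (hX _) this

lemma prop_add_iff (i n : ℕ) (hH : ∀ j < n, S (H j)) :
    S (extModule (i + n) N (Y 0)) ↔ S (extModule i N (Y n)) := by
  induction n generalizing i with
  | zero => rfl
  | succ n ih =>
    rw [← h.prop_succ_iff i n (hH n (by lia)), ← ih (i + 1) fun j hj ↦ hH j (by lia)]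
    ring_nf

theorem prop_iff_add (i n : ℕ) (hH : ∀ j < n, S (H j))
    (hH' : ∀ j, n < j → j ≤ n + i → S (H j)) :
    S (extModule i N (H n)) ↔ S (extModule (i + n) N (Y 0)) := by
  rw [h.prop_add_iff i n hH, h.prop_iff i n hH']

end ExtShiftSequence

/-! ### Torsion submodules of injectives -/

section Torsion

variable {R : Type u} [CommRing R] (a : Ideal R)

lemma Ideal.exists_pow_smul_eq_zero_of_finite {N : Type*} [AddCommGroup N] [Module R N]
    [Module.Finite R N] (hN : ∀ x : N, ∃ k, ∀ r ∈ a ^ k, r • x = 0) :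
    ∃ k, ∀ r ∈ a ^ k, ∀ x : N, r • x = 0 := by
  obtain ⟨s, hs⟩ := Module.Finite.fg_top (R := R) (M := N)
  choose k hk using hN
  refine ⟨s.sup k, fun r hr x ↦ ?_⟩
  have hx : x ∈ Submodule.span R (s : Set N) := hs ▸ Submodule.mem_top
  induction hx using Submodule.span_induction with
  | mem x hx => exact hk x r (Ideal.pow_le_pow_right (Finset.le_sup (f := k) hx) hr)
  | zero => exact smul_zero r
  | add x y _ _ hx hy => rw [smul_add, hx, hy, add_zero]
  | smul c x _ hx => rw [smul_comm, hx, smul_zero]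

lemma Ideal.mem_primaryComponent_iff {M : Type*} [AddCommGroup M] [Module R M] (x : M) :
    x ∈ Ideal.primaryComponent M a ↔ ∃ k : ℕ, ∀ r ∈ a ^ k, r • x = 0 := by
  simp only [Ideal.primaryComponent_mem, Submodule.mem_torsionBySet_iff, SetLike.coe_sort_coe,
    Subtype.forall]

lemma Ideal.primaryComponent_injective [IsNoetherianRing R] (E : Type u) [AddCommGroup E]
    [Module R E] [Module.Injective R E] : Module.Injective R (Ideal.primaryComponent E a) := by
  refine Module.Baer.injective fun I f ↦ ?_
  obtain ⟨k, hk⟩ := a.exists_pow_smul_eq_zero_of_finite (N := LinearMap.range f) (by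
    rintro ⟨x, -⟩
    obtain ⟨k, hk⟩ := (a.mem_primaryComponent_iff x.1).1 x.2
    exact ⟨k, fun r hr ↦ Subtype.ext (Subtype.ext (hk r hr))⟩)
  -- Artin–Rees: a^(c+k) ∩ I ⊆ a^k I, where f vanishes. So f factors through the image of I in
  -- R/a^(c+k), and an extension to R/a^(c+k) with values in E automatically has a-torsion values.
  obtain ⟨c, hc⟩ := a.exists_pow_inf_eq_pow_smul (M := R) I
  specialize hc (c + k) (by lia)
  let J : Ideal R := a ^ (c + k)
  have hf (x : I) (hx : (x : R) ∈ J) : f x = 0 := by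
    have hx' : (x : R) ∈ a ^ (c + k - c) • (a ^ c • (⊤ : Submodule R R) ⊓ I) := by
      rw [← hc]
      exact ⟨by simpa using hx, x.2⟩
    have hx'' : (x : R) ∈ a ^ k • I := by
      rw [Nat.add_sub_cancel_left] at hx'
      exact Submodule.smul_mono le_rfl inf_le_right hx'
    suffices ∀ y : R, y ∈ a ^ k • I → ∃ hy : y ∈ I, f ⟨y, hy⟩ = 0 from (this x hx'').2
    intro y hy
    refine Submodule.smul_induction_on hy (fun r hr n hn ↦ ⟨I.mul_mem_left r hn, ?_⟩) ?_
    · have := congrArg Subtype.val (hk r hr ⟨f ⟨n, hn⟩, LinearMap.mem_range_self _ _⟩)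
      exact (f.map_smul r ⟨n, hn⟩).trans this
    · rintro y z ⟨hy, hy'⟩ ⟨hz, hz'⟩
      refine ⟨I.add_mem hy hz, ?_⟩
      have := f.map_add ⟨y, hy⟩ ⟨z, hz⟩
      rwa [hy', hz', add_zero] at this
  let φ : I →ₗ[R] R ⧸ J := J.mkQ ∘ₗ I.subtype
  obtain ⟨g, hg⟩ := Module.Injective.out ((LinearMap.ker φ).liftQ φ le_rfl)
    (LinearMap.ker_eq_bot.1 (Submodule.ker_liftQ_eq_bot _ _ _ le_rfl))
    ((LinearMap.ker φ).liftQ ((Ideal.primaryComponent E a).subtype ∘ₗ f) (by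
      intro x hx
      rw [LinearMap.mem_ker, LinearMap.comp_apply, hf x, map_zero]
      exact (Submodule.Quotient.mk_eq_zero J).1 hx))
  refine ⟨(g ∘ₗ J.mkQ).codRestrict _ fun x ↦ ?_, fun x hx ↦ Subtype.ext ?_⟩
  · refine (a.mem_primaryComponent_iff _).2 ⟨c + k, fun r hr ↦ ?_⟩
    rw [← map_smul]
    have : J.mkQ (r • x) = 0 := (Submodule.Quotient.mk_eq_zero J).2 (J.mul_mem_right x hr)
    rw [LinearMap.comp_apply, this, map_zero]
  · exact hg (Submodule.Quotient.mk ⟨x, hx⟩)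

lemma Ideal.injective_quotient_primaryComponent [IsNoetherianRing R] (M : ModuleCat.{u} R)
    [Injective M] : Injective (ModuleCat.of R (M ⧸ Ideal.primaryComponent M a)) := by
  have : Module.Injective R M := Module.injective_module_of_injective_object R M
  have := a.primaryComponent_injective M
  obtain ⟨r, hr⟩ := Module.Injective.out (Ideal.primaryComponent M a).subtype
    Subtype.val_injective LinearMap.id
  let s : (M ⧸ Ideal.primaryComponent M a) →ₗ[R] M :=
    (Ideal.primaryComponent M a).liftQ
      (LinearMap.id - (Ideal.primaryComponent M a).subtype ∘ₗ r) fun x hx ↦ by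
        have := hr ⟨x, hx⟩
        simp only [Submodule.subtype_apply, LinearMap.id_apply] at this
        simp [this]
  refine Retract.injective (Y := M) ⟨ModuleCat.ofHom s,
    ModuleCat.ofHom (Ideal.primaryComponent M a).mkQ, ?_⟩
  ext x
  simp [s]

lemma Ideal.eq_zero_of_torsion_of_quotient_primaryComponent [IsNoetherianRing R] {N M : Type*}
    [AddCommGroup N] [Module R N] [AddCommGroup M] [Module R M]
    (hN : Ideal.primaryComponent N a = ⊤) (f : N →ₗ[R] M ⧸ Ideal.primaryComponent M a) :
    f = 0 := by
  ext x
  obtain ⟨y, hy⟩ := (Ideal.primaryComponent M a).mkQ_surjective (f x)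
  obtain ⟨k, hk⟩ := (a.mem_primaryComponent_iff x).1 (hN ▸ Submodule.mem_top)
  have hy' (r : R) (hr : r ∈ a ^ k) : r • y ∈ Ideal.primaryComponent M a := by
    rw [← Submodule.Quotient.mk_eq_zero, ← Submodule.mkQ_apply, map_smul, hy, ← map_smul,
      hk r hr, map_zero]
  let φ : (a ^ k : Ideal R) →ₗ[R] M := LinearMap.toSpanSingleton R M y ∘ₗ (a ^ k).subtype
  -- a^k y is finitely generated and a-torsion, so a single power a^l kills it.
  obtain ⟨l, hl⟩ := a.exists_pow_smul_eq_zero_of_finite (N := LinearMap.range φ) (by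
    rintro ⟨-, r, rfl⟩
    obtain ⟨l, hl⟩ := (a.mem_primaryComponent_iff _).1 (hy' r.1 r.2)
    exact ⟨l, fun t ht ↦ Subtype.ext (hl t ht)⟩)
  suffices y ∈ Ideal.primaryComponent M a by
    rw [← hy, LinearMap.zero_apply]
    exact (Submodule.Quotient.mk_eq_zero _).2 this
  refine (a.mem_primaryComponent_iff y).2 ⟨l + k, fun t ht ↦ ?_⟩
  rw [pow_add] at ht
  induction ht using Submodule.mul_induction_on' with
  | mem_mul_mem r hr s hs =>
    rw [mul_smul]
    exact congrArg Subtype.val (hl r hr ⟨φ ⟨s, hs⟩, LinearMap.mem_range_self _ _⟩)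
  | add r _ s _ hr hs => rw [add_smul, hr, hs, add_zero]

lemma subsingleton_ext_quotient_primaryComponent [IsNoetherianRing R] {N : ModuleCat.{u} R}
    (hN : IsIdealTorsion a N) (M : ModuleCat.{u} R) [Injective M] (i : ℕ) :
    Subsingleton (Abelian.Ext.{u} N (ModuleCat.of R (M ⧸ Ideal.primaryComponent M a)) i) := by
  cases i with
  | zero =>
    refine (Abelian.Ext.linearEquiv₀ (R := R)).toEquiv.subsingleton_congr.2 ⟨fun f g ↦ ?_⟩
    ext1
    rw [a.eq_zero_of_torsion_of_quotient_primaryComponent hN f.hom,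
      a.eq_zero_of_torsion_of_quotient_primaryComponent hN g.hom]
  | succ i =>
    have := a.injective_quotient_primaryComponent M
    exact Abelian.Ext.subsingleton_of_injective _ _ _

end Torsion

/-! ### Cycles modulo torsion boundaries -/

section TorsionCycles

variable {R : Type u} [CommRing R] (a : Ideal R)
  {A B C D : Type u} [AddCommGroup A] [Module R A] [AddCommGroup B] [Module R B]
  [AddCommGroup C] [Module R C] [AddCommGroup D] [Module R D]

/-- The image of `Γ_a(A)` under `f`, as a submodule of the kernel of `g`. -/
abbrev torsionBoundaries (f : A →ₗ[R] B) (g : B →ₗ[R] C) : Submodule R (LinearMap.ker g) :=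
  ((Ideal.primaryComponent A a).map f).comap (LinearMap.ker g).subtype

/-- The cycles in `B` modulo the boundaries coming from `Γ_a(A)`. -/
abbrev TorsionCycles (f : A →ₗ[R] B) (g : B →ₗ[R] C) : Type u :=
  LinearMap.ker g ⧸ torsionBoundaries a f g

/-- The map from cycles modulo torsion boundaries to `B / Γ_a(B)`. -/
def torsionCyclesToQuotient (f : A →ₗ[R] B) (g : B →ₗ[R] C) :
    TorsionCycles a f g →ₗ[R] B ⧸ Ideal.primaryComponent B a :=
  (torsionBoundaries a f g).mapQ _ (LinearMap.ker g).subtype (by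
    rintro x ⟨y, hy, hyx⟩
    rw [Submodule.mem_comap, ← hyx]
    exact Ideal.primaryComponent_map_mem a f ⟨y, hy⟩)

/-- The map from `B / Γ_a(B)` to the cycles in `C` modulo torsion boundaries. -/
def quotientToTorsionCycles (g : B →ₗ[R] C) (h : C →ₗ[R] D) (hgh : Function.Exact g h) :
    (B ⧸ Ideal.primaryComponent B a) →ₗ[R] TorsionCycles a g h :=
  (Ideal.primaryComponent B a).mapQ _
    (g.codRestrict (LinearMap.ker h) fun x ↦ hgh.apply_apply_eq_zero x)
    fun x hx ↦ ⟨x, hx, rfl⟩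

lemma quotientToTorsionCycles_surjective (g : B →ₗ[R] C) (h : C →ₗ[R] D)
    (hgh : Function.Exact g h) : Function.Surjective (quotientToTorsionCycles a g h hgh) := by
  intro y
  obtain ⟨⟨y, hy⟩, rfl⟩ := Submodule.mkQ_surjective _ y
  obtain ⟨x, rfl⟩ := (hgh y).1 hy
  exact ⟨Submodule.Quotient.mk x, rfl⟩

lemma exact_torsionCyclesToQuotient_quotientToTorsionCycles (f : A →ₗ[R] B) (g : B →ₗ[R] C)
    (h : C →ₗ[R] D) (hgh : Function.Exact g h) :
    Function.Exact (torsionCyclesToQuotient a f g) (quotientToTorsionCycles a g h hgh) := by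
  intro y
  obtain ⟨y, rfl⟩ := Submodule.mkQ_surjective _ y
  constructor
  · intro hy
    obtain ⟨x, hx, hxy⟩ := (Submodule.Quotient.mk_eq_zero _).1 hy
    refine ⟨Submodule.Quotient.mk ⟨y - x, ?_⟩, ?_⟩
    · rw [LinearMap.mem_ker, map_sub, hxy]
      exact sub_self _
    · refine (Submodule.Quotient.eq _).2 ?_
      simpa using hx
  · rintro ⟨x, hx⟩
    obtain ⟨⟨x, hx'⟩, rfl⟩ := Submodule.mkQ_surjective _ x
    rw [← hx]
    refine (Submodule.Quotient.mk_eq_zero _).2 ?_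
    have : g.codRestrict (LinearMap.ker h) (fun x ↦ hgh.apply_apply_eq_zero x) x = 0 :=
      Subtype.ext hx'
    exact this ▸ Submodule.zero_mem _

/-- The homology of `Γ_a(A) → Γ_a(B) → Γ_a(C)` is the kernel of `torsionCyclesToQuotient`. -/
lemma nonempty_homology_linearEquiv_ker (f : A →ₗ[R] B) (g : B →ₗ[R] C)
    (h : ∀ x, Ideal.primaryComponent.map a f x ∈ LinearMap.ker (Ideal.primaryComponent.map a g)) :
    Nonempty ((LinearMap.ker (Ideal.primaryComponent.map a g) ⧸
      LinearMap.range ((Ideal.primaryComponent.map a f).codRestrict _ h)) ≃ₗ[R]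
        LinearMap.ker (torsionCyclesToQuotient a f g)) := by
  let θ : LinearMap.ker (Ideal.primaryComponent.map a g) →ₗ[R] TorsionCycles a f g :=
    Submodule.mkQ _ ∘ₗ ((Ideal.primaryComponent B a).subtype ∘ₗ
      (LinearMap.ker (Ideal.primaryComponent.map a g)).subtype).codRestrict (LinearMap.ker g)
        fun x ↦ congrArg Subtype.val x.2
  have hker : LinearMap.ker θ =
      LinearMap.range ((Ideal.primaryComponent.map a f).codRestrict _ h) := by
    ext x
    constructor
    · intro hx
      obtain ⟨y, hy, hyx⟩ := (Submodule.Quotient.mk_eq_zero _).1 hx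
      exact ⟨⟨y, hy⟩, Subtype.ext (Subtype.ext hyx)⟩
    · rintro ⟨y, rfl⟩
      exact (Submodule.Quotient.mk_eq_zero _).2 ⟨y.1, y.2, rfl⟩
  have hrange : LinearMap.range θ = LinearMap.ker (torsionCyclesToQuotient a f g) := by
    ext y
    constructor
    · rintro ⟨x, rfl⟩
      exact (Submodule.Quotient.mk_eq_zero _).2 x.1.2
    · obtain ⟨y, rfl⟩ := Submodule.mkQ_surjective _ y
      intro hy
      exact ⟨⟨⟨y.1, (Submodule.Quotient.mk_eq_zero _).1 hy⟩, Subtype.ext y.2⟩, rfl⟩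
  exact ⟨Submodule.quotEquivOfEq _ _ hker.symm ≪≫ₗ θ.quotKerEquivRange ≪≫ₗ
    LinearEquiv.ofEq _ _ hrange⟩

end TorsionCycles

/-! ### Local cohomology from an injective resolution -/

section LocalCohomology

variable {R : Type u} [CommRing R] (a : Ideal R)

lemma nonempty_iso_localCohomologyModule {X : ModuleCat.{u} R} (I : InjectiveResolution X)
    (i j k : ℕ) (hi : (ComplexShape.up ℕ).prev j = i) (hk : (ComplexShape.up ℕ).next j = k) :
    Nonempty (ModuleCat.of R (LinearMap.ker
      (torsionCyclesToQuotient a (I.cocomplex.d i j).hom (I.cocomplex.d j k).hom)) ≅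
        localCohomologyModule a j X) := by
  let K := ((torsionFunctor a).mapHomologicalComplex (ComplexShape.up ℕ)).obj I.cocomplex
  obtain ⟨e⟩ := nonempty_homology_linearEquiv_ker a (I.cocomplex.d i j).hom
    (I.cocomplex.d j k).hom (fun x ↦ (K.sc' i j k).moduleCat_zero_apply x)
  exact ⟨e.symm.toModuleIso ≪≫ (K.sc' i j k).moduleCatHomologyIso.symm ≪≫
    (K.homologyIsoSc' i j k hi hk).symm ≪≫ (I.isoRightDerivedObj (torsionFunctor a) j).symm⟩

/-- The cycles of an injective resolution modulo the images of the torsion submodules. -/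
noncomputable def resolutionTorsionCycles {X : ModuleCat.{u} R} (I : InjectiveResolution X)
    (p : ℕ) : ModuleCat.{u} R :=
  ModuleCat.of R (TorsionCycles a (I.cocomplex.d (p - 1) p).hom (I.cocomplex.d p (p + 1)).hom)

lemma nonempty_iso_resolutionTorsionCycles_zero {X : ModuleCat.{u} R}
    (I : InjectiveResolution X) : Nonempty (X ≅ resolutionTorsionCycles a I 0) := by
  -- For p = 0 the truncated p - 1 is 0, and `d 0 0` is zero.
  have hd : torsionBoundaries a (I.cocomplex.d 0 0).hom (I.cocomplex.d 0 1).hom = ⊥ := by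
    rw [I.cocomplex.shape 0 0 (by simp), ModuleCat.hom_zero]
    ext x
    simp
  exact ⟨Limits.IsLimit.conePointUniqueUpToIso I.isLimitKernelFork
    (ModuleCat.kernelIsLimit (I.cocomplex.d 0 1)) ≪≫
      (Submodule.quotEquivOfEqBot _ hd).symm.toModuleIso⟩

lemma extShiftSequence_localCohomologyModule [IsNoetherianRing R]
    (S : ObjectProperty (ModuleCat.{u} R)) [S.IsSerreClass] {N : ModuleCat.{u} R}
    (hN : IsIdealTorsion a N) {X : ModuleCat.{u} R} (I : InjectiveResolution X) :
    ExtShiftSequence S N (fun i ↦ localCohomologyModule a i X)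
      (resolutionTorsionCycles a I) where
  exists_shortExact p := by
    let ψ := torsionCyclesToQuotient a (I.cocomplex.d (p - 1) p).hom (I.cocomplex.d p (p + 1)).hom
    have hd : Function.Exact (I.cocomplex.d p (p + 1)).hom
        (I.cocomplex.d (p + 1) (p + 1 + 1)).hom := by
      have := I.exact_succ p
      rwa [ShortComplex.ShortExact.moduleCat_exact_iff_function_exact] at this
    refine ⟨_, _, ModuleCat.shortExact_mk_of_linear (LinearMap.ker ψ).subtype ψ.rangeRestrict
      Subtype.val_injective ?_ ψ.surjective_rangeRestrict,
      ModuleCat.shortExact_mk_of_linear (LinearMap.range ψ).subtype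
        (quotientToTorsionCycles a (I.cocomplex.d p (p + 1)).hom
          (I.cocomplex.d (p + 1) (p + 1 + 1)).hom hd) Subtype.val_injective ?_
        (quotientToTorsionCycles_surjective a _ _ hd), ?_, rfl, rfl, rfl, fun i ↦ ?_⟩
    · rw [LinearMap.exact_iff, LinearMap.ker_rangeRestrict, Submodule.range_subtype]
    · rw [LinearMap.exact_iff, Submodule.range_subtype, ← LinearMap.exact_iff]
      exact exact_torsionCyclesToQuotient_quotientToTorsionCycles a _ _ _ hd
    · refine nonempty_iso_localCohomologyModule a I (p - 1) p (p + 1) ?_ (by simp)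
      -- `prev 0 = 0` agrees with truncated subtraction.
      cases p <;> simp
    · have := subsingleton_ext_quotient_primaryComponent a hN (I.cocomplex.X p) i
      exact prop_of_subsingleton S _

end LocalCohomology

theorem corollary2p8 {R : Type u} [CommRing R] [IsNoetherianRing R] (a : Ideal R)
    (S : ObjectProperty (ModuleCat.{u} R)) [S.IsSerreClass]
    (N : ModuleCat.{u} R) [Module.Finite R N] (hN : IsIdealTorsion a N)
    (X : ModuleCat.{u} R) (n m : ℕ) (hnm : n ≤ m) :
    ((∀ i : ℕ, i ≠ n → S (localCohomologyModule a i X)) →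
      ∀ i : ℕ, S (extModule i N (localCohomologyModule a n X)) ↔ S (extModule (i + n) N X)) ∧
    ((∀ i : ℕ, (i < n ∨ (n + 1 ≤ i ∧ i ≤ m)) → S (localCohomologyModule a i X)) →
      ∀ i : ℕ, i ≤ m - n →
        (S (extModule i N (localCohomologyModule a n X)) ↔ S (extModule (i + n) N X))) := by
  let I := injectiveResolution X
  have h := extShiftSequence_localCohomologyModule a S hN I
  obtain ⟨e⟩ := nonempty_iso_resolutionTorsionCycles_zero a I
  constructor
  · intro hS i
    rw [extModule_prop_iff_of_iso S _ N e]
    exact h.prop_iff_add i n (fun j hj ↦ hS j (by lia)) fun j hj _ ↦ hS j (by lia)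
  · intro hS i hi
    rw [extModule_prop_iff_of_iso S _ N e]
    exact h.prop_iff_add i n (fun j hj ↦ hS j (by lia)) fun j hj _ ↦ hS j (by lia)
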